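/- **Dense Model Theorem with a linear threshold and $\ell = O(\log(1/\delta)/(\epsilon/\delta)^2)$.** For distributions $W, V$ on the same finite set, say that $W$ is $\delta$-dense in $V$ if $\Pr[W=x]\le \Pr[V=x]/\delta$ for every $x$. For a class $\mathcal F$ of boolean functions and $\epsilon>0$, say that $P$ and $Q$ are $(\mathcal F,\epsilon)$-indistinguishable if $|\mathbb E f(P)-\mathbb E f(Q)|\le\epsilon$ for every $f\in\mathcal F$. A linear threshold function $g:\{0,1\}^\ell\to\{0,1\}$ is one for which there are $w_1,\dots,w_\ell,t\in\mathbb R$ such that $g(b)=1$ if and only if $\sum_{i} w_i b_i\ge t$. There are absolute constants $C_1,C_2>0$ such that the following holds. Let $n\ge 0$, let $\mathcal D'$ be any class of functions $\{0,1\}^n\to\{0,1\}$, let $\epsilon>0$ and $0<\delta\le 1$, let $R$ be uniform over $\{0,1\}^n$, let $X$ be an $n$-bit random variable and let $X'$ be $\delta$-dense in $X$. Put $$\ell=\max\left(1,\left\lceil C_2\,\frac{\log(1/\delta)}{(\epsilon/\delta)^2}\right\rceil\right),$$ and let $\mathcal D$ be the class of all functions $x\mapsto g(D_1(x),\dots,D_\ell(x))$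 where $D_1,\dots,D_\ell\in\mathcal D'$ and $g$ is a linear threshold function. If $X$ and $R$ are $(\mathcal D,\epsilon)$-indistinguishable, then there exists a distribution $R'$ that is $\delta$-dense in $R$ such that $X'$ and $R'$ are $(\mathcal D',\epsilon')$-indistinguishable, where $\epsilon'=C_1\,\epsilon/\delta$. -/

import Mathlib

open scoped BigOperators

noncomputable section

/-- `n`-bit strings. -/
abbrev BitStr (n : ℕ) : Type := Fin n → Bool

/-- `W` is `δ`-dense in `V`: `Pr[W = x] ≤ Pr[V = x] / δ` for every `x`. -/
def IsDenseIn {α : Type*} (δ : ℝ) (W V : PMF α) : Prop :=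
  ∀ x, (W x).toReal ≤ (V x).toReal / δ

/-- The expectation `𝔼 f(P)`, that is `Pr[f(P) = 1]`, of a boolean function `f` under the
distribution `P`. -/
def acceptProb {α : Type*} [Fintype α] (P : PMF α) (f : α → Bool) : ℝ :=
  ∑ x, (P x).toReal * (if f x = true then 1 else 0)

/-- `P` and `Q` are `(F, ε)`-indistinguishable: every test in the class `F` has advantage at
most `ε`. -/
def Indistinguishable {α : Type*} [Fintype α] (F : Set (α → Bool)) (ε : ℝ) (P Q : PMF α) : Prop :=
  ∀ f ∈ F, |acceptProb P f - acceptProb Q f| ≤ ε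

/-- `g` is a linear threshold function: `g b = 1` iff `w₁ b₁ + ⋯ + w_ℓ b_ℓ ≥ t`, for some real
weights `w` and some real threshold `t`. -/
def IsLinearThreshold {ℓ : ℕ} (g : BitStr ℓ → Bool) : Prop :=
  ∃ (w : Fin ℓ → ℝ) (t : ℝ), ∀ b, g b = true ↔ t ≤ ∑ i, w i * (if b i = true then 1 else 0)

/-- All functions `g(D₁, …, D_ℓ)` with `D₁, …, D_ℓ ∈ D'` (repetitions allowed) and `g` a linear
threshold function. -/
def thresholdClass {α : Type*} (D' : Set (α → Bool)) (ℓ : ℕ) : Set (α → Bool) :=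
  {f | ∃ (g : BitStr ℓ → Bool) (D : Fin ℓ → α → Bool),
    IsLinearThreshold g ∧ (∀ i, D i ∈ D') ∧ f = fun x => g fun i => D i x}

end

/-! Suppose every `R'` dense in `R` is told apart from `X'` by a test. Run multiplicative weights:
reweight `R` by `exp (η F - t)` capped at `1 / δ`, with `η = ε / δ` and `t` normalizing, and add to
`F` a signed test separating `X'` from this density. Since `cappedExp` has derivative `min (exp u)
A`, the normalizing `t` minimizes `t + 𝔼_R cappedExp (η F - t)`. By `potential_step`, this potential
minus `η 𝔼_{X'} F` drops by at least `5η² - η²` per round.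

It cannot fall far. Density of `X'` in `X` bounds `η 𝔼_{X'} F` by `t + L` plus `1 / δ` times the
mean excess of `η F` over `t + L` under `X`. By `sum_mul_comp_le_of_level_sets`, level sets of `F`
being thresholds of tests, passing from `X` to `R` costs `2Tη²`; under `R` the excess is the linear
tail of the potential. Hence `4Tη² ≤ L + 2Tη²`, against `L ≤ Tη²`. -/

/-- The exponential up to height `A = exp L`, continued linearly with slope `A` beyond `L`. -/
noncomputable def cappedExp (A L u : ℝ) : ℝ := min (Real.exp u) A + A * max (u - L) 0

lemma cappedExp_of_le {A L u : ℝ} (hA : Real.exp L = A) (h : u ≤ L) :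
    cappedExp A L u = Real.exp u ∧ min (Real.exp u) A = Real.exp u := by
  have h1 : Real.exp u ≤ A := hA ▸ Real.exp_le_exp.2 h
  simp [cappedExp, min_eq_left h1, max_eq_right (sub_nonpos.2 h)]

lemma cappedExp_of_ge {A L u : ℝ} (hA : Real.exp L = A) (h : L ≤ u) :
    cappedExp A L u = A * (1 + u - L) ∧ min (Real.exp u) A = A := by
  have h1 : A ≤ Real.exp u := hA ▸ Real.exp_le_exp.2 h
  refine ⟨?_, min_eq_right h1⟩
  rw [cappedExp, min_eq_right h1, max_eq_left (sub_nonneg.2 h)]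
  ring

/-- The tangent line inequality for the exponential at `u`. -/
lemma exp_mul_one_add_sub_le (u v : ℝ) : Real.exp u * (1 + (v - u)) ≤ Real.exp v := by
  have h : Real.exp v = Real.exp u * Real.exp (v - u) := by rw [← Real.exp_add]; ring_nf
  rw [h]
  have := Real.add_one_le_exp (v - u)
  gcongr
  linarith

lemma exp_add_le_of_abs_le_one (u : ℝ) {h : ℝ} (hh : |h| ≤ 1) :
    Real.exp (u + h) ≤ Real.exp u * (1 + h + h ^ 2) := by
  rw [Real.exp_add]
  have := (abs_le.1 (Real.abs_exp_sub_one_sub_id_le hh)).2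
  gcongr
  linarith

/-- `cappedExp` lies above its tangents. -/
lemma cappedExp_tangent_le {A L : ℝ} (hA : Real.exp L = A) (u v : ℝ) :
    cappedExp A L u + min (Real.exp u) A * (v - u) ≤ cappedExp A L v := by
  have hA0 : 0 < A := hA ▸ Real.exp_pos L
  rcases le_total u L with hu | hu <;> rcases le_total v L with hv | hv
  · rw [(cappedExp_of_le hA hu).1, (cappedExp_of_le hA hu).2, (cappedExp_of_le hA hv).1]
    linarith [exp_mul_one_add_sub_le u v]
  · rw [(cappedExp_of_le hA hu).1, (cappedExp_of_le hA hu).2, (cappedExp_of_ge hA hv).1]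
    have h1 := exp_mul_one_add_sub_le u L
    have h2 : Real.exp u ≤ A := hA ▸ Real.exp_le_exp.2 hu
    rw [hA] at h1
    nlinarith [mul_le_mul_of_nonneg_right h2 (sub_nonneg.2 hv)]
  · rw [(cappedExp_of_ge hA hu).1, (cappedExp_of_ge hA hu).2, (cappedExp_of_le hA hv).1]
    have h1 := exp_mul_one_add_sub_le L v
    rw [hA] at h1
    linarith
  · rw [(cappedExp_of_ge hA hu).1, (cappedExp_of_ge hA hu).2, (cappedExp_of_ge hA hv).1]
    linarith

/-- Second-order upper bound for `cappedExp`. -/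
lemma cappedExp_add_le {A L : ℝ} (hA : Real.exp L = A) (u : ℝ) {h : ℝ} (hh : |h| ≤ 1) :
    cappedExp A L (u + h) ≤ cappedExp A L u + min (Real.exp u) A * (h + h ^ 2) := by
  have hA0 : 0 < A := hA ▸ Real.exp_pos L
  rcases le_total u L with hu | hu <;> rcases le_total (u + h) L with hv | hv
  · rw [(cappedExp_of_le hA hu).1, (cappedExp_of_le hA hu).2, (cappedExp_of_le hA hv).1]
    linarith [exp_add_le_of_abs_le_one u hh]
  · rw [(cappedExp_of_le hA hu).1, (cappedExp_of_le hA hu).2, (cappedExp_of_ge hA hv).1]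
    -- The linear tail is the tangent of `exp` at `L`, so it stays below `exp`.
    have h1 := exp_mul_one_add_sub_le L (u + h)
    rw [hA] at h1
    linarith [exp_add_le_of_abs_le_one u hh]
  · rw [(cappedExp_of_ge hA hu).1, (cappedExp_of_ge hA hu).2, (cappedExp_of_le hA hv).1]
    -- Expand at `L` instead of `u`: only the part of the step below `L` is curved.
    have hk : |u + h - L| ≤ |h| := by
      rw [abs_of_nonpos (by linarith), abs_of_nonpos (by linarith)]
      linarith
    have h1 := exp_add_le_of_abs_le_one L (hk.trans hh)
    rw [hA, add_sub_cancel] at h1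
    nlinarith [mul_le_mul_of_nonneg_left (sq_le_sq.2 hk) hA0.le]
  · rw [(cappedExp_of_ge hA hu).1, (cappedExp_of_ge hA hu).2, (cappedExp_of_ge hA hv).1]
    nlinarith [mul_nonneg hA0.le (sq_nonneg h)]

/-- A density `exp u` capped at `A ≥ 1` can be normalized by a shift of `u`. -/
lemma exists_sum_mul_min_exp_eq_one {α : Type*} [Fintype α] {p : α → ℝ} (hp : ∀ x, 0 ≤ p x)
    (hp1 : ∑ x, p x = 1) {A : ℝ} (hA : 1 ≤ A) (u : α → ℝ) :
    ∃ t, ∑ x, p x * min (Real.exp (u x - t)) A = 1 := by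
  have hA0 : 0 < A := by linarith
  have hu : ∀ x, |u x| ≤ ∑ y, |u y| := fun x =>
    Finset.single_le_sum (f := fun y => |u y|) (fun y _ => abs_nonneg _) (Finset.mem_univ x)
  set M := ∑ y, |u y|
  refine mem_range_of_exists_le_of_exists_ge
    (f := fun t => ∑ x, p x * min (Real.exp (u x - t)) A) (by fun_prop) ⟨M, ?_⟩
    ⟨-M - Real.log A, ?_⟩
  · rw [← hp1]
    refine Finset.sum_le_sum fun x _ => mul_le_of_le_one_right (hp x) ((min_le_left _ _).trans ?_)
    exact Real.exp_le_one_iff.2 (by linarith [(abs_le.1 (hu x)).2])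
  · rw [← hp1]
    refine Finset.sum_le_sum fun x _ => le_mul_of_one_le_right (hp x) (le_min ?_ hA)
    exact Real.one_le_exp (by linarith [(abs_le.1 (hu x)).1, Real.log_nonneg hA])

/-- Discrete layer-cake estimate: if all level sets `{j ≤ F}` of an integer-valued function
have `d`-weight at most `ε` and `h` has increments in `[0, η]`, then `∑ d · h(F) ≤ 2 T ε η`. -/
lemma sum_mul_comp_le_of_level_sets {α : Type*} [Fintype α] {d : α → ℝ} (hd : ∑ x, d x = 0)
    {F : α → ℤ} {T : ℕ} (hF : ∀ x, |F x| ≤ T) {ε η : ℝ}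
    (hε : ∀ j : ℤ, ∑ x, d x * (if j ≤ F x then 1 else 0) ≤ ε)
    {h : ℤ → ℝ} (h0 : ∀ j, 0 ≤ h (j + 1) - h j) (h1 : ∀ j, h (j + 1) - h j ≤ η) (hε0 : 0 ≤ ε) :
    ∑ x, d x * h (F x) ≤ 2 * T * ε * η := by
  -- Telescoping from `-T`; the constant `h (-T)` later vanishes because `d` has total weight zero.
  have key : ∀ m : ℤ, -T ≤ m → ∀ N : ℕ, m ≤ -T + N → h m = h (-T) +
      ∑ i ∈ Finset.range N, (h (-T + i + 1) - h (-T + i)) * (if -T + i + 1 ≤ m then 1 else 0) := by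
    intro m hm N hN
    obtain ⟨k, rfl⟩ : ∃ k : ℕ, m = -T + k := ⟨(m + T).toNat, by omega⟩
    have hk : k ≤ N := by omega
    have e : ∀ i : ℕ, (-(T : ℤ) + i + 1 ≤ -T + k) ↔ i < k := fun i => by omega
    simp only [e, mul_ite, mul_one, mul_zero]
    rw [← Finset.sum_filter]
    have : (Finset.range N).filter (· < k) = Finset.range k := by
      ext i; simp; omega
    rw [this]
    have := Finset.sum_range_sub (fun i : ℕ => h (-T + i)) k
    push_cast at this
    simp only [← add_assoc] at this
    rw [this]
    simp
  have e : ∀ x, d x * h (F x) = d x * h (-T) + ∑ i ∈ Finset.range (2 * T),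
      (h (-T + i + 1) - h (-T + i)) * (d x * (if -T + i + 1 ≤ F x then 1 else 0)) := by
    intro x
    have := abs_le.1 (hF x)
    rw [key (F x) this.1 (2 * T) (by push_cast; linarith), mul_add, Finset.mul_sum]
    congr 1
    exact Finset.sum_congr rfl fun i _ => by ring
  rw [Finset.sum_congr rfl fun x _ => e x, Finset.sum_add_distrib, ← Finset.sum_mul, hd, zero_mul,
    zero_add, Finset.sum_comm]
  simp only [← Finset.mul_sum]
  calc _ ≤ ∑ _i ∈ Finset.range (2 * T), η * ε := by
        refine Finset.sum_le_sum fun i _ => ?_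
        exact (mul_le_mul_of_nonneg_left (hε _) (h0 _)).trans
          (mul_le_mul_of_nonneg_right (h1 _) hε0)
    _ = 2 * T * ε * η := by simp; ring

/-- `F` is a sum of `T` functions of the form `±D` with `D ∈ D'`. -/
def IsSignedSum {α : Type*} (D' : Set (α → Bool)) (T : ℕ) (F : α → ℤ) : Prop :=
  ∃ (w : Fin T → ℤ) (D : Fin T → α → Bool), (∀ i, |w i| = 1) ∧ (∀ i, D i ∈ D') ∧
    ∀ x, F x = ∑ i, w i * (if D i x = true then 1 else 0)

lemma IsSignedSum.zero {α : Type*} (D' : Set (α → Bool)) : IsSignedSum D' 0 (fun _ => 0) :=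
  ⟨Fin.elim0, Fin.elim0, fun i => i.elim0, fun i => i.elim0, fun x => by simp⟩

lemma IsSignedSum.add {α : Type*} {D' : Set (α → Bool)} {T : ℕ} {F : α → ℤ}
    (hF : IsSignedSum D' T F) {D : α → Bool} (hD : D ∈ D') {σ : ℤ} (hσ : |σ| = 1) :
    IsSignedSum D' (T + 1) (fun x => F x + σ * (if D x = true then 1 else 0)) := by
  obtain ⟨w, E, hw, hE, h⟩ := hF
  refine ⟨Fin.snoc w σ, Fin.snoc (α := fun _ => α → Bool) E D, fun i => ?_, fun i => ?_,
    fun x => ?_⟩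
  · induction i using Fin.lastCases <;> simp [hσ, hw]
  · induction i using Fin.lastCases <;> simp [hD, hE]
  · simp [Fin.sum_univ_castSucc, h x]

lemma IsSignedSum.abs_le {α : Type*} {D' : Set (α → Bool)} {T : ℕ} {F : α → ℤ}
    (hF : IsSignedSum D' T F) (x : α) : |F x| ≤ T := by
  obtain ⟨w, E, hw, hE, h⟩ := hF
  rw [h]
  refine (Finset.abs_sum_le_sum_abs _ _).trans ?_
  calc _ ≤ ∑ _i : Fin T, (1 : ℤ) := Finset.sum_le_sum fun i _ => by
        rw [abs_mul, hw]; split_ifs <;> simp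
    _ = T := by simp

/-- The signs serve as weights and `j` as threshold, so exactly `T` tests are used. -/
lemma IsSignedSum.decide_le_mem_thresholdClass {α : Type*} {D' : Set (α → Bool)} {T : ℕ}
    {F : α → ℤ} (hF : IsSignedSum D' T F) (j : ℤ) :
    (fun x => decide (j ≤ F x)) ∈ thresholdClass D' T := by
  obtain ⟨w, E, hw, hE, h⟩ := hF
  refine ⟨fun b => decide (j ≤ ∑ i, w i * (if b i = true then 1 else 0)), E,
    ⟨fun i => w i, j, fun b => ?_⟩, hE, by simp [h]⟩
  rw [decide_eq_true_iff, ← Int.cast_le (R := ℝ)]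
  push_cast
  rfl

lemma sum_toReal_eq_one {α : Type*} [Fintype α] (P : PMF α) : ∑ x, (P x).toReal = 1 := by
  rw [← ENNReal.toReal_sum fun x _ => P.apply_ne_top x, ← tsum_fintype (L := .unconditional _),
    P.tsum_coe, ENNReal.toReal_one]

lemma acceptProb_mem_Icc {α : Type*} [Fintype α] (P : PMF α) (f : α → Bool) :
    acceptProb P f ∈ Set.Icc (0 : ℝ) 1 := by
  constructor
  · exact Finset.sum_nonneg fun x _ => mul_nonneg ENNReal.toReal_nonneg (by split_ifs <;> simp)
  · rw [← sum_toReal_eq_one P]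
    exact Finset.sum_le_sum fun x _ =>
      mul_le_of_le_one_right ENNReal.toReal_nonneg (by split_ifs <;> simp)

/-- A nonnegative real function with sum one as the weights of a `PMF`. -/
lemma exists_pmf_toReal_eq {α : Type*} [Fintype α] {p : α → ℝ} (hp : ∀ x, 0 ≤ p x)
    (hp1 : ∑ x, p x = 1) : ∃ P : PMF α, ∀ x, (P x).toReal = p x :=
  ⟨PMF.ofFintype (fun x => ENNReal.ofReal (p x)) (by
    rw [← ENNReal.ofReal_sum_of_nonneg fun x _ => hp x, hp1, ENNReal.ofReal_one]),
    fun x => by simp [hp x]⟩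

/-- One step of the multiplicative weights argument: adding to `F` a signed test `σ D` that
separates `Q` from the capped Gibbs density of `F` by `γ` improves the potential. -/
lemma potential_step {α : Type*} [Fintype α] {p : α → ℝ} (hp : ∀ x, 0 ≤ p x)
    {A L : ℝ} (hA : Real.exp L = A) {u v : α → ℝ} {η t t' : ℝ}
    (hη1 : η ≤ 1) (huv : ∀ x, |v x| ≤ η)
    (ht : ∑ x, p x * min (Real.exp (u x - t)) A = 1)
    (ht' : ∑ x, p x * min (Real.exp (u x + v x - t')) A = 1) :
    t' + ∑ x, p x * cappedExp A L (u x + v x - t') ≤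
      t + ∑ x, p x * cappedExp A L (u x - t) +
        ∑ x, p x * min (Real.exp (u x - t)) A * v x + η ^ 2 := by
  have hA0 : 0 < A := hA ▸ Real.exp_pos L
  -- Optimality of `t'`: the tangents at `t'` have mean slope 1 by `ht'`.
  have h1 : ∑ x, p x * cappedExp A L (u x + v x - t') + (t' - t) ≤
      ∑ x, p x * cappedExp A L (u x + v x - t) := by
    rw [← one_mul (t' - t), ← ht', Finset.sum_mul, ← Finset.sum_add_distrib]
    refine Finset.sum_le_sum fun x _ => ?_
    have := mul_le_mul_of_nonneg_left
      (cappedExp_tangent_le hA (u x + v x - t') (u x + v x - t)) (hp x)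
    linarith
  have h2 : ∑ x, p x * cappedExp A L (u x + v x - t) ≤ ∑ x, p x * cappedExp A L (u x - t) +
        ∑ x, p x * min (Real.exp (u x - t)) A * v x + η ^ 2 := by
    rw [← one_mul (η ^ 2), ← ht, Finset.sum_mul, ← Finset.sum_add_distrib,
      ← Finset.sum_add_distrib]
    refine Finset.sum_le_sum fun x _ => ?_
    have h3 := cappedExp_add_le hA (u x - t) ((huv x).trans hη1)
    rw [sub_add_eq_add_sub] at h3
    have h4 : v x ^ 2 ≤ η ^ 2 := sq_le_sq.2 ((huv x).trans (le_abs_self η))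
    have h5 : 0 ≤ min (Real.exp (u x - t)) A := le_min (Real.exp_pos _).le hA0.le
    have h6 := mul_le_mul_of_nonneg_left (h3.trans (add_le_add_right
      (mul_le_mul_of_nonneg_left (add_le_add_right h4 (v x)) h5) _)) (hp x)
    linarith
  linarith

/-- Multiplicative weights: if every distribution `δ`-dense in `R` is `γ`-distinguished from `Q`
by a test in `D'`, then there are signed sums of tests of low potential relative to `Q`. -/
lemma exists_isSignedSum_potential_le {α : Type*} [Fintype α] {D' : Set (α → Bool)}
    {R Q : PMF α} {δ η γ L : ℝ} (hδ : 0 < δ) (hδ1 : δ ≤ 1) (hη0 : 0 ≤ η) (hη1 : η ≤ 1)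
    (hL : Real.exp L = 1 / δ)
    (H : ∀ R' : PMF α, IsDenseIn δ R' R → ¬ Indistinguishable D' γ Q R') (T : ℕ) :
    ∃ F : α → ℤ, IsSignedSum D' T F ∧ ∃ t : ℝ,
      ∑ x, (R x).toReal * min (Real.exp (η * F x - t)) (1 / δ) = 1 ∧
      t + ∑ x, (R x).toReal * cappedExp (1 / δ) L (η * F x - t) ≤
        1 + η * ∑ x, (Q x).toReal * F x - T * (η * γ) + T * η ^ 2 := by
  have hA1 : 1 ≤ 1 / δ := by rwa [one_le_div hδ]
  have hL0 : 0 ≤ L := by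
    rw [← hL] at hA1
    exact Real.one_le_exp_iff.1 hA1
  have hR : ∀ x, 0 ≤ (R x).toReal := fun x => ENNReal.toReal_nonneg
  induction T with
  | zero =>
    refine ⟨_, IsSignedSum.zero D', 0, ?_, ?_⟩
    · simp [min_eq_left (by simpa using hA1 : 1 ≤ δ⁻¹), sum_toReal_eq_one]
    · simp [(cappedExp_of_le hL hL0).1, sum_toReal_eq_one, -one_div]
  | succ T ih =>
    obtain ⟨F, hF, t, ht, hpot⟩ := ih
    obtain ⟨R', hR'⟩ := exists_pmf_toReal_eq
      (fun x => mul_nonneg (hR x) (le_min (Real.exp_pos (η * F x - t)).le (by linarith))) ht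
    have hdense : IsDenseIn δ R' R := fun x => by
      rw [hR', div_eq_mul_one_div (R x).toReal]
      exact mul_le_mul_of_nonneg_left (min_le_right _ _) (hR x)
    have hdist := H R' hdense
    simp only [Indistinguishable, not_forall, not_le] at hdist
    obtain ⟨D, hD, hDγ⟩ := hdist
    obtain ⟨σ, hσ, hσγ⟩ : ∃ σ : ℤ, |σ| = 1 ∧ γ ≤ σ * (acceptProb Q D - acceptProb R' D) := by
      rcases lt_abs.1 hDγ with h | h
      · exact ⟨1, by simp, by simpa using h.le⟩
      · exact ⟨-1, by simp, by simpa using h.le⟩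
    obtain ⟨t', ht'⟩ := exists_sum_mul_min_exp_eq_one hR (sum_toReal_eq_one R) hA1
      (fun x => η * F x + η * (σ * (if D x = true then 1 else 0)))
    have hcast : ∀ x, η * ((F x + σ * (if D x = true then 1 else 0) : ℤ) : ℝ) =
        η * F x + η * (σ * (if D x = true then 1 else 0)) := fun x => by
      push_cast; ring
    have hstep := potential_step hR hL hη1 (v := fun x => η * (σ * (if D x = true then 1 else 0)))
      (fun x => by
        have : |(σ : ℝ)| = 1 := by exact_mod_cast hσ
        rw [abs_mul, abs_mul, this, abs_of_nonneg hη0]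
        split_ifs <;> simp [hη0]) ht ht'
    refine ⟨_, hF.add hD hσ, t', by simpa only [hcast] using ht', ?_⟩
    simp only [hcast]
    refine hstep.trans ?_
    have e1 : ∑ x, (R x).toReal * min (Real.exp (η * F x - t)) (1 / δ) *
        (η * (σ * (if D x = true then 1 else 0))) = η * (σ * acceptProb R' D) := by
      simp only [acceptProb, Finset.mul_sum, hR']
      exact Finset.sum_congr rfl fun x _ => by ring
    have e2 : ∑ x, (Q x).toReal * ((F x + σ * (if D x = true then 1 else 0) : ℤ) : ℝ) =
        ∑ x, (Q x).toReal * F x + σ * acceptProb Q D := by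
      simp only [acceptProb, Finset.mul_sum, ← Finset.sum_add_distrib]
      exact Finset.sum_congr rfl fun x _ => by push_cast; ring
    rw [e1, e2]
    have := mul_le_mul_of_nonneg_left hσγ hη0
    push_cast
    linarith

/-- Dense model theorem for an arbitrary finite ground set and an arbitrary distribution `R`,
with an explicit number of tests. -/
theorem exists_dense_model {α : Type*} [Fintype α] {D' : Set (α → Bool)} {R X X' : PMF α}
    {ε δ : ℝ} {T : ℕ} (hε : 0 < ε) (hδ : 0 < δ) (hδ1 : δ ≤ 1) (hT : 1 ≤ T)
    (hTL : Real.log (1 / δ) / (ε / δ) ^ 2 ≤ T) (hX : IsDenseIn δ X' X)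
    (hind : Indistinguishable (thresholdClass D' T) ε X R) :
    ∃ R' : PMF α, IsDenseIn δ R' R ∧ Indistinguishable D' (5 * (ε / δ)) X' R' := by
  have hη : 0 < ε / δ := by positivity
  -- For `ε / δ > 1` the claim is trivial, as no advantage exceeds 1.
  rcases lt_or_ge 1 (ε / δ) with hη1 | hη1
  · refine ⟨R, fun x => le_div_self ENNReal.toReal_nonneg hδ hδ1, fun f _ => ?_⟩
    have h1 := acceptProb_mem_Icc X' f
    have h2 := acceptProb_mem_Icc R f
    rw [abs_le]
    constructor <;> linarith [h1.1, h1.2, h2.1, h2.2]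
  by_contra! H
  set L := Real.log (1 / δ) with hLdef
  have hL : Real.exp L = 1 / δ := Real.exp_log (by positivity)
  set η := ε / δ with hηdef
  obtain ⟨F, hF, t, ht, hpot⟩ := exists_isSignedSum_potential_le hδ hδ1 hη.le hη1 hL H T
  have hX' : η * ∑ x, (X' x).toReal * F x ≤
      t + L + 1 / δ * ∑ x, (X x).toReal * max (η * F x - (t + L)) 0 := by
    have hs : t + L = ∑ x, (X' x).toReal * (t + L) := by
      rw [← Finset.sum_mul, sum_toReal_eq_one, one_mul]
    refine le_of_le_of_eq ?_ (congrArg (· + _) hs.symm)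
    rw [Finset.mul_sum, Finset.mul_sum, ← Finset.sum_add_distrib]
    refine Finset.sum_le_sum fun x _ => ?_
    have h1 := mul_le_mul_of_nonneg_left (le_max_left (η * F x - (t + L)) 0)
      (ENNReal.toReal_nonneg (a := X' x))
    have h2 := mul_le_mul_of_nonneg_right (hX x) (le_max_right (η * F x - (t + L)) 0)
    rw [div_eq_mul_one_div] at h2
    linarith
  have hlayer : ∑ x, ((X x).toReal - (R x).toReal) * max (η * F x - (t + L)) 0 ≤
      2 * T * ε * η := by
    refine sum_mul_comp_le_of_level_sets (h := fun j : ℤ => max (η * j - (t + L)) 0)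
      (by simp [sum_toReal_eq_one]) hF.abs_le (fun j => ?_) (fun j => ?_) (fun j => ?_) hε.le
    · have := (abs_le.1 (hind _ (hF.decide_le_mem_thresholdClass j))).2
      simpa only [acceptProb, sub_mul, Finset.sum_sub_distrib, decide_eq_true_eq] using this
    · push_cast
      exact sub_nonneg.2 (max_le_max (by linarith) le_rfl)
    · push_cast
      rw [sub_le_iff_le_add]
      refine max_le ?_ ?_
      · linarith [le_max_left (η * j - (t + L)) 0]
      · linarith [le_max_right (η * j - (t + L)) 0]
  simp only [sub_mul, Finset.sum_sub_distrib] at hlayer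
  have hcap : ∑ x, (R x).toReal * cappedExp (1 / δ) L (η * F x - t) =
      1 + 1 / δ * ∑ x, (R x).toReal * max (η * F x - (t + L)) 0 := by
    refine Eq.trans ?_ (congrArg (· + _) ht)
    rw [Finset.mul_sum, ← Finset.sum_add_distrib]
    refine Finset.sum_congr rfl fun x _ => ?_
    rw [cappedExp, sub_sub]
    ring
  have hlayer' := mul_le_mul_of_nonneg_left hlayer (by positivity : 0 ≤ 1 / δ)
  have e : 1 / δ * (2 * T * ε * η) = 2 * T * η ^ 2 := by rw [hηdef]; ring
  rw [e] at hlayer'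
  rw [div_le_iff₀ (by positivity)] at hTL
  -- Strictness needs `1 ≤ T`: for `δ = 1` one has `L = 0`.
  have hpos : 0 < T * η ^ 2 := by
    have : (0 : ℝ) < T := by exact_mod_cast hT
    positivity
  linarith

theorem mainTheorem5 :
    ∃ C₁ C₂ : ℝ, 0 < C₁ ∧ 0 < C₂ ∧
      ∀ (n : ℕ) (D' : Set (BitStr n → Bool)) (ε δ : ℝ), 0 < ε → 0 < δ → δ ≤ 1 →
        ∀ X X' : PMF (BitStr n), IsDenseIn δ X' X →
          Indistinguishable
            (thresholdClass D' (max 1 ⌈C₂ * (Real.log (1 / δ) / (ε / δ) ^ 2)⌉₊)) ε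
            X (PMF.uniformOfFintype (BitStr n)) →
          ∃ R' : PMF (BitStr n), IsDenseIn δ R' (PMF.uniformOfFintype (BitStr n)) ∧
            Indistinguishable D' (C₁ * (ε / δ)) X' R' := by

  refine ⟨5, 1, by norm_num, one_pos, ?_⟩
  intro n D' ε δ hε hδ hδ1 X X' hX hind
  refine exists_dense_model hε hδ hδ1 (le_max_left _ _) ?_ hX hind
  rw [one_mul]
  exact (Nat.le_ceil _).trans (by exact_mod_cast le_max_right _ _)
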